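/- Let $n\ge 4$ be even, $v_a=e^{\mathbf i a\pi/n}$ for $a\in\mathbb Z$, and for $0\le i<j\le n-1$ let $T_{i,j}=\{\lambda v_i+\mu v_j: 0\le\lambda,\mu\le1\}$ be the unit rhombus prototiles. Tiles are translates of prototiles; a patch is a finite, simply connected, edge-to-edge set of tiles. **Candidate substitutions.** Let $w$ be the infinite word over $\{0,2,\dots,n-2\}$ obtained by travelling along the line $t\mapsto t\,(\cos\frac{j\pi}{n})_{0\le j<n/2}+(\frac12,\dots,\frac12)$ of $\mathbb R^{n/2}$ from $t=0$ in the positive direction and writing the letter $2j$ each time a hyperplane $\{x_j=k\}$, $k\in\mathbb N$, is crossed. For $i\in\mathbb N$ let $u^{(i)}$ be the prefix of $w$ of length $i$ followed by its mirror image. Read as an edgeword, the letter $0$ is a unit edge (length $1$) and a letter $2h>0$ is a rhombus of angle $2h\pi/n$ bisected through that angle (length $2\cos\frac{h\pi}{n}$); let $\mu$ be the total length of $u^{(i)}$ and $\phi(z)=\mu z$. A candidate substitution $\sigma=\sigma'_{i,n}$ assigns to every prototile $p$ a metatile $\sigma(p)$: a finite edge-to-edge set of tiles that has the edges and rhombuses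 of $u^{(i)}$ along each of the four edges of the expanded prototile $\phi(p)$, and whose union is exactly the union of $\phi(p)$ and these boundary rhombuses. It acts on sets of tiles by replacing $x+p$ with $\phi(x)+\sigma(p)$, common boundary rhombuses being identified. It is *well-defined* if every iterate $\sigma^k(p)$ is edge-to-edge (no overlaps), and it satisfies the *corner condition* if in every corner of every metatile there is, along each of the two sides, a narrow rhombus with its angle $\pi/n$ at that corner. **Proposition.** Let $n\ge4$ be even and let $i\in\mathbb N$. Suppose that $\sigma=\sigma'_{i,n}$ is a well-defined candidate substitution that satisfies the corner condition. Let $S$ be the star pattern, i.e. the $2n$ rhombuses of angle $\pi/n$ around the vertex $0$. Then: 1. $S$ is a seed for $\sigma$: it is a patch, it lies at the centre of $\sigma(S)$ (that is, $S\subseteq\sigma(S)$, both being centred at $0=\phi(0)$), and $\sigma(S)$ contains a disc centred at $0$ which is strictly larger than the circumscribed disc of $S$; 2. $S$ is legal for $\sigma$: a translate of $S$ is contained in $\sigma^k(p)$ for some prototile $p$ and some $k$; more precisely, for every prototile $p$ a translate of $S$ is contained in $\sigma^{n/2+1}(p)$. -/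

import Mathlib

noncomputable section

namespace PlanarRosa

/-! ### Directions, tiles, patterns -/

/-- The unit vector `v_a = e^{𝐢 a π / n}`, for every integer `a`; so `v_{a+n} = - v_a`. -/
def dir (n : ℕ) (a : ℤ) : ℂ := Complex.exp (((a : ℝ) * Real.pi / (n : ℝ) : ℝ) * Complex.I)

/-- The closed rhombus with vertex `x` spanned by `v_a` and `v_b`. -/
def rhombus (n : ℕ) (x : ℂ) (a b : ℤ) : Set ℂ :=
  {z | ∃ s ∈ Set.Icc (0 : ℝ) 1, ∃ t ∈ Set.Icc (0 : ℝ) 1,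
    z = x + (s : ℂ) * dir n a + (t : ℂ) * dir n b}

/-- The types `{i, j}`, `0 ≤ i < j ≤ n - 1`, of prototiles (tiles up to translation). -/
structure Prototile (n : ℕ) where
  i : ℕ
  j : ℕ
  i_lt_j : i < j
  j_lt_n : j < n

/-- The tile of type `p` at position `x`. -/
def tile (n : ℕ) (x : ℂ) (p : Prototile n) : Set ℂ := rhombus n x p.i p.j

/-- The corners `(c, a, b)` of a prototile: `c` is a vertex and, near `c`, the prototile is the
sector swept counterclockwise from the direction `v_a` to the direction `v_b`, of angle
`(b - a) π / n` with `1 ≤ b - a ≤ n - 1`. -/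
def Prototile.corners {n : ℕ} (p : Prototile n) : List (ℂ × ℤ × ℤ) :=
  [ (0, (p.i : ℤ), (p.j : ℤ)),
    (dir n p.i, (p.j : ℤ), (p.i : ℤ) + n),
    (dir n p.i + dir n p.j, (p.i : ℤ) + n, (p.j : ℤ) + n),
    (dir n p.j, (p.j : ℤ) + n, (p.i : ℤ) + 2 * n) ]

/-- The four edges `(c, a)` of a prototile: the unit segment from `c` to `c + v_a`. -/
def Prototile.edges {n : ℕ} (p : Prototile n) : List (ℂ × ℤ) :=
  [ (0, (p.i : ℤ)), (dir n p.j, (p.i : ℤ)), (0, (p.j : ℤ)), (dir n p.i, (p.j : ℤ)) ]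

/-- `s` is a tile, i.e. a translate of a prototile. -/
def IsTile (n : ℕ) (s : Set ℂ) : Prop := ∃ (x : ℂ) (p : Prototile n), s = tile n x p

/-- `z` is a vertex of the tile `s`. -/
def IsVertex (n : ℕ) (s : Set ℂ) (z : ℂ) : Prop :=
  ∃ (x : ℂ) (p : Prototile n), s = tile n x p ∧ ∃ k ∈ p.corners, z = x + k.1

/-- `e` is an edge of the tile `s`. -/
def IsEdge (n : ℕ) (s e : Set ℂ) : Prop :=
  ∃ (x : ℂ) (p : Prototile n), s = tile n x p ∧
    ∃ k ∈ p.edges, e = segment ℝ (x + k.1) (x + k.1 + dir n k.2)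

/-- A set of tiles which is edge-to-edge: two distinct tiles that intersect share exactly a common
vertex or exactly a full common edge (in particular their interiors do not overlap). -/
def EdgeToEdge (n : ℕ) (P : Set (Set ℂ)) : Prop :=
  (∀ s ∈ P, IsTile n s) ∧
  ∀ s ∈ P, ∀ t ∈ P, s ≠ t →
    s ∩ t = ∅ ∨
    (∃ z, IsVertex n s z ∧ IsVertex n t z ∧ s ∩ t = {z}) ∨
    (∃ e, IsEdge n s e ∧ IsEdge n t e ∧ s ∩ t = e)

/-- A finite patch: a finite, edge-to-edge, simply connected set of tiles. -/
def IsPatch (n : ℕ) (P : Set (Set ℂ)) : Prop :=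
  P.Finite ∧ EdgeToEdge n P ∧ SimplyConnectedSpace (⋃₀ P : Set ℂ)

/-- The translate by `x` of a set of tiles. -/
def shift (x : ℂ) (P : Set (Set ℂ)) : Set (Set ℂ) := (fun s => (fun z => x + z) '' s) '' P

/-- The pattern of `P` (that is, `P` up to translation) appears in `Q`. -/
def Appears (P Q : Set (Set ℂ)) : Prop := ∃ x : ℂ, shift x P ⊆ Q

/-- The star pattern, centred at `0`: the `2n` rhombuses of angle `π / n` around one vertex. -/
def star (n : ℕ) : Set (Set ℂ) :=
  {s | ∃ m : ℕ, m < 2 * n ∧ s = rhombus n 0 (m : ℤ) ((m : ℤ) + 1)}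

/-! ### The billiard word and the candidate edgewords -/

/-- The line `t ↦ t γ + (1/2, …, 1/2)` of `ℝ^{n/2}`, with `γ = (cos (i π / n))_{0 ≤ i < n/2}`, lies
at time `t` on a hyperplane `x_i = k` with `k ∈ ℕ`. -/
def Crosses (n : ℕ) (t : ℝ) (i : ℕ) : Prop :=
  i < n / 2 ∧ ∃ k : ℕ, t * Real.cos ((i : ℝ) * Real.pi / (n : ℝ)) + 1 / 2 = (k : ℝ)

/-- The successive times at which the line, travelled from `t = 0` on, crosses a hyperplane:
`crossingTime n 0 = 0` is the starting time, and `crossingTime n m` for `m ≥ 1` is the time of the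
`m`-th crossing. -/
def crossingTime (n : ℕ) : ℕ → ℝ
  | 0 => 0
  | m + 1 => sInf {t : ℝ | crossingTime n m < t ∧ ∃ i, Crosses n t i}

/-- The infinite billiard word `w = w_0 w_1 w_2 …`: the letter `2 i` is written when a hyperplane
`x_i = k` is crossed. (For even `n` two hyperplanes are never crossed at once, so the `i` below is
the only one.) -/
def billiardWord (n : ℕ) (m : ℕ) : ℕ := 2 * sInf {i : ℕ | Crosses n (crossingTime n (m + 1)) i}

/-- The candidate edgeword: the prefix of length `i` of the billiard word followed by its mirror
image. -/
def candidateWord (n i : ℕ) : List ℕ :=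
  (List.range i).map (billiardWord n) ++ ((List.range i).map (billiardWord n)).reverse

/-! ### Substitutions given by an edgeword

A letter `0` of an edgeword is a unit edge, an even letter `l > 0` is a rhombus of angle `l π / n`
bisected through that angle. -/

/-- The length along the edge of a letter: `1` for a unit edge, and the diagonal of the rhombus for
a bisected rhombus. -/
def letterLength (n : ℕ) (l : ℕ) : ℝ :=
  if l = 0 then 1 else 2 * Real.cos (((l / 2 : ℕ) : ℝ) * Real.pi / (n : ℝ))

/-- The expansion factor `μ` of an edgeword; the expansion is `φ z = μ z`. -/
def factor (n : ℕ) (u : List ℕ) : ℝ := (u.map (letterLength n)).sum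

/-- The rhombuses read along the word `u` laid from the point `y` in the direction `v_a`. -/
def edgeTiles (n : ℕ) : List ℕ → ℂ → ℤ → Set (Set ℂ)
  | [], _, _ => ∅
  | l :: u, y, a =>
    (if l = 0 then ∅ else {rhombus n y (a - (l / 2 : ℕ)) (a + (l / 2 : ℕ))}) ∪
      edgeTiles n u (y + (letterLength n l : ℂ) * dir n a) a

/-- The unit edges read along the word `u` laid from the point `y` in the direction `v_a`. -/
def edgeSegments (n : ℕ) : List ℕ → ℂ → ℤ → Set (Set ℂ)
  | [], _, _ => ∅
  | l :: u, y, a =>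
    (if l = 0 then {segment ℝ y (y + dir n a)} else ∅) ∪
      edgeSegments n u (y + (letterLength n l : ℂ) * dir n a) a

/-- The boundary rhombuses of the metatile of `p`: those of the words laid along the four expanded
edges of `p`. -/
def boundaryTiles (n : ℕ) (u : List ℕ) (p : Prototile n) : Set (Set ℂ) :=
  {s | ∃ k ∈ p.edges, s ∈ edgeTiles n u ((factor n u : ℂ) * k.1) k.2}

/-- The boundary unit edges of the metatile of `p`. -/
def boundarySegments (n : ℕ) (u : List ℕ) (p : Prototile n) : Set (Set ℂ) :=
  {e | ∃ k ∈ p.edges, e ∈ edgeSegments n u ((factor n u : ℂ) * k.1) k.2}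

/-- A substitution with edgeword `u`: for each prototile `p` a tiling of the metatile of `p` that
`u` determines, i.e. a finite edge-to-edge set of tiles which has the letters of `u` (rhombuses and
unit edges) along each of the four expanded edges of `p`, and which covers exactly the expanded
prototile together with these boundary rhombuses (one half of each of them juts out). -/
structure Substitution (n : ℕ) (u : List ℕ) where
  metatile : Prototile n → Set (Set ℂ)
  finite : ∀ p, (metatile p).Finite
  edgeToEdge : ∀ p, EdgeToEdge n (metatile p)
  boundaryTiles_subset : ∀ p, boundaryTiles n u p ⊆ metatile p
  boundarySegments_edges : ∀ p, ∀ e ∈ boundarySegments n u p, ∃ s ∈ metatile p, IsEdge n s e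
  covers : ∀ p, ⋃₀ (metatile p) =
    (fun z : ℂ => (factor n u : ℂ) * z) '' (tile n 0 p) ∪ ⋃₀ (boundaryTiles n u p)

namespace Substitution

variable {n : ℕ} {u : List ℕ}

/-- The image of a set of tiles: the tile of type `p` at position `x` is replaced by the metatile of
`p` placed at `φ x`, and the images are glued along their common boundary tiles. -/
def apply (σ : Substitution n u) (P : Set (Set ℂ)) : Set (Set ℂ) :=
  {s | ∃ (x : ℂ) (p : Prototile n), tile n x p ∈ P ∧
    s ∈ shift ((factor n u : ℂ) * x) (σ.metatile p)}

/-- The metatile `σ^k (p)` of order `k`. -/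
def iterate (σ : Substitution n u) (k : ℕ) (p : Prototile n) : Set (Set ℂ) :=
  σ.apply^[k] {tile n 0 p}

/-- The substitution extends to its whole sequence of metatiles: the glueings never create tiles
that overlap or that fail to be edge-to-edge. -/
def WellDefined (σ : Substitution n u) : Prop :=
  ∀ (k : ℕ) (p : Prototile n), EdgeToEdge n (σ.iterate k p)

/-- The corner condition: in every corner of every metatile there is, along each of the two sides,
a narrow rhombus having its angle `π / n` at the corner. -/
def CornerCondition (σ : Substitution n u) : Prop :=
  ∀ p : Prototile n, ∀ k ∈ p.corners,
    rhombus n ((factor n u : ℂ) * k.1) k.2.1 (k.2.1 + 1) ∈ σ.metatile p ∧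
    rhombus n ((factor n u : ℂ) * k.1) (k.2.2 - 1) k.2.2 ∈ σ.metatile p

/-- A pattern is legal if it appears in some `σ^k (p)`. -/
def IsLegal (σ : Substitution n u) (P : Set (Set ℂ)) : Prop :=
  ∃ (p : Prototile n) (k : ℕ), Appears P (σ.iterate k p)

end Substitution

/-- The disc with centre `c` and radius `R` is the circumscribed (smallest enclosing) disc of
`K`. -/
def IsCircumscribed (K : Set ℂ) (c : ℂ) (R : ℝ) : Prop :=
  K ⊆ Metric.closedBall c R ∧ ∀ (c' : ℂ) (R' : ℝ), K ⊆ Metric.closedBall c' R' → R ≤ R'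

/-- `S` is a seed: a patch, with centre `c` (the centre of its circumscribed circle), which lies at
the centre `φ c` of its own image `σ (S)`, and such that `σ (S)` contains a disc with centre `φ c`
that is strictly larger than the circumscribed disc of `S`. -/
def Substitution.IsSeed {n : ℕ} {u : List ℕ} (σ : Substitution n u) (S : Set (Set ℂ)) : Prop :=
  IsPatch n S ∧ ∃ (c : ℂ) (R r : ℝ),
    IsCircumscribed (⋃₀ S) c R ∧
    shift ((factor n u : ℂ) * c - c) S ⊆ σ.apply S ∧
    R < r ∧ Metric.closedBall ((factor n u : ℂ) * c) r ⊆ ⋃₀ (σ.apply S)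

end PlanarRosa

end

namespace PlanarRosa

/-! Cut the directions at a vertex into the 2n sectors of angle π/n. A tile with a corner at that
vertex occupies an interval of sectors, whose length (its width) is between 1 and n - 1.

The engine is that a substitution shrinks widths. In a metatile corner of width d, the corner
condition puts narrow rhombuses on the two outermost sectors. Edge-to-edge tiles cannot share a
sector at a common vertex, so any other tile in the corner has width at most d - 2. Hence if a tile
of width d at z covers a sector, then in the image that sector at φ(z) is covered by a tile of width
at most max(1, d - 2) (`exists_narrower_corner`, `exists_narrower_apply`).

For legality, a vertex completely surrounded by tiles is needed to start from. A vertex of the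
narrow rhombus in a metatile corner lies in the interior of the expanded prototile
(`exists_interior_vertex`). Its widths are at most n - 1, and n/2 further substitutions bring them
all to 1, which is the star.

For the seed property, width 1 is stable, so the star reappears at 0. The star contains the unit
disc, so its image contains the disc of radius μ ≥ 2, while the circumscribed radius |1 + v_1| is
less than 2. The bound μ ≥ 2 holds because the billiard word starts with the letter 0 and the
edgeword is mirrored (`two_le_factor`). -/

/-! ### Arithmetic of directions and coordinates in two directions. -/

theorem dir_add (n : ℕ) (a b : ℤ) : dir n (a + b) = dir n a * dir n b := by
  unfold dir
  rw [← Complex.exp_add]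
  congr 1
  push_cast
  ring

theorem dir_zero (n : ℕ) : dir n 0 = 1 := by simp [dir]

theorem dir_natCast {n : ℕ} (hn : 0 < n) : dir n n = -1 := by
  have h : ((n : ℤ) : ℝ) * Real.pi / (n : ℝ) = Real.pi := by
    push_cast
    field_simp
  rw [dir, h, Complex.exp_pi_mul_I]

theorem dir_add_n {n : ℕ} (hn : 0 < n) (a : ℤ) : dir n (a + n) = -dir n a := by
  rw [dir_add, dir_natCast hn]
  ring

theorem dir_add_period {n : ℕ} (hn : 0 < n) (a l : ℤ) : dir n (a + 2 * n * l) = dir n a := by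
  have h : ((2 * n * l : ℤ) : ℝ) * Real.pi / (n : ℝ) = l * (2 * Real.pi) := by
    push_cast
    field_simp
  have h' : dir n (2 * n * l) = 1 := by
    rw [dir, h, Complex.exp_eq_one_iff]
    exact ⟨l, by push_cast; ring⟩
  rw [dir_add, h', mul_one]

theorem dir_re (n : ℕ) (a : ℤ) : (dir n a).re = Real.cos (a * Real.pi / n) := by
  rw [dir, Complex.exp_ofReal_mul_I_re]

theorem dir_im (n : ℕ) (a : ℤ) : (dir n a).im = Real.sin (a * Real.pi / n) := by
  rw [dir, Complex.exp_ofReal_mul_I_im]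

theorem norm_dir (n : ℕ) (a : ℤ) : ‖dir n a‖ = 1 := Complex.norm_exp_ofReal_mul_I _

theorem dir_ne_zero (n : ℕ) (a : ℤ) : dir n a ≠ 0 := Complex.exp_ne_zero _

theorem dir_neg_im (n : ℕ) (a : ℤ) : (dir n (-a)).im = -(dir n a).im := by
  rw [dir_im, dir_im, ← Real.sin_neg]
  congr 1
  push_cast
  ring

theorem dir_add_n_im {n : ℕ} (hn : 0 < n) (a : ℤ) : (dir n (a + n)).im = -(dir n a).im := by
  rw [dir_add_n hn, Complex.neg_im]

theorem dir_im_nonneg {n : ℕ} (hn : 0 < n) {a : ℤ} (h0 : 0 ≤ a) (h1 : a ≤ n) :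
    0 ≤ (dir n a).im := by
  rw [dir_im]
  have hn' : (0 : ℝ) < n := by exact_mod_cast hn
  have h0' : (0 : ℝ) ≤ a := by exact_mod_cast h0
  have h1' : (a : ℝ) ≤ n := by exact_mod_cast h1
  apply Real.sin_nonneg_of_nonneg_of_le_pi
  · positivity
  · rw [div_le_iff₀ hn', mul_comm]
    exact mul_le_mul_of_nonneg_left h1' Real.pi_pos.le

theorem dir_im_pos {n : ℕ} {a : ℤ} (h0 : 0 < a) (h1 : a < n) : 0 < (dir n a).im := by
  rw [dir_im]
  have h0' : (0 : ℝ) < a := by exact_mod_cast h0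
  have h1' : (a : ℝ) < n := by exact_mod_cast h1
  have hn' : (0 : ℝ) < n := h0'.trans h1'
  apply Real.sin_pos_of_pos_of_lt_pi
  · positivity
  · rw [div_lt_iff₀ hn', mul_comm]
    exact mul_lt_mul_of_pos_left h1' Real.pi_pos

/-- Rotating a combination of two directions and taking imaginary parts. -/
theorem rotate_im (n : ℕ) (c a b : ℤ) (s t : ℝ) :
    (dir n (-c) * ((s : ℂ) * dir n a + (t : ℂ) * dir n b)).im =
      s * (dir n (a - c)).im + t * (dir n (b - c)).im := by
  have h : dir n (-c) * ((s : ℂ) * dir n a + (t : ℂ) * dir n b) =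
      (s : ℂ) * dir n (a - c) + (t : ℂ) * dir n (b - c) := by
    rw [sub_eq_add_neg, sub_eq_add_neg, dir_add, dir_add]
    ring
  rw [h, Complex.add_im, Complex.im_ofReal_mul, Complex.im_ofReal_mul]

/-- Every complex number in the coordinates given by two directions. -/
theorem decompose (n : ℕ) (a b : ℤ) (w : ℂ) :
    ((dir n (b - a)).im : ℂ) * w =
      ((-(dir n (-b) * w).im : ℝ) : ℂ) * dir n a + (((dir n (-a) * w).im : ℝ) : ℂ) * dir n b := by
  have hba : (dir n (b - a)).im = Real.sin (b * Real.pi / n - a * Real.pi / n) := by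
    rw [dir_im]
    congr 1
    push_cast
    ring
  have hna : (((-a : ℤ) : ℝ)) * Real.pi / n = -(a * Real.pi / n) := by push_cast; ring
  have hnb : (((-b : ℤ) : ℝ)) * Real.pi / n = -(b * Real.pi / n) := by push_cast; ring
  rw [hba]
  apply Complex.ext <;>
  · simp only [Complex.add_re, Complex.add_im, Complex.mul_re, Complex.mul_im, Complex.ofReal_re,
      Complex.ofReal_im, dir_re, dir_im, hna, hnb, Real.sin_neg, Real.cos_neg, Real.sin_sub]
    ring

/-- Two directions that differ by less than half a turn are linearly independent. -/
theorem coeff_eq_zero {n : ℕ} {a b : ℤ} (hab : a < b) (hba : b < a + n) {s t : ℝ}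
    (h : (s : ℂ) * dir n a + (t : ℂ) * dir n b = 0) : s = 0 ∧ t = 0 := by
  have hd : 0 < (dir n (b - a)).im := dir_im_pos (by omega) (by omega)
  have ha := rotate_im n a a b s t
  have hb := rotate_im n b a b s t
  rw [h, mul_zero, Complex.zero_im] at ha hb
  have e : a - b = -(b - a) := by ring
  rw [e, dir_neg_im] at hb
  simp only [sub_self, dir_zero, Complex.one_im, mul_zero, zero_add, add_zero] at ha hb
  constructor
  · nlinarith [mul_eq_zero.1 (show s * (dir n (b - a)).im = 0 by linarith)]
  · exact (mul_eq_zero.1 ha.symm).resolve_right hd.ne'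

/-- Cramer's rule. The explicit quotients are kept because the signs and sizes of the coordinates
are later read off from them. -/
theorem exists_coeff {n : ℕ} {a b : ℤ} (hab : a < b) (hba : b < a + n) (w : ℂ) :
    ∃ s t : ℝ, w = (s : ℂ) * dir n a + (t : ℂ) * dir n b ∧
      s = -(dir n (-b) * w).im / (dir n (b - a)).im ∧
      t = (dir n (-a) * w).im / (dir n (b - a)).im := by
  have hd : 0 < (dir n (b - a)).im := dir_im_pos (by omega) (by omega)
  refine ⟨_, _, ?_, rfl, rfl⟩
  have hd' : ((dir n (b - a)).im : ℂ) ≠ 0 := by exact_mod_cast hd.ne'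
  apply mul_left_cancel₀ hd'
  rw [decompose n a b w]
  push_cast
  field_simp

theorem dir_neg_mul_dir (n : ℕ) (a b : ℤ) : dir n (-a) * dir n b = dir n (b - a) := by
  rw [← dir_add]
  congr 1
  ring

/-- A direction between `v_a` and `v_b` lies in the cone that they span. -/
theorem exists_coeff_dir {n : ℕ} {a b m : ℤ} (hab : a < b) (hba : b < a + n)
    (ham : a ≤ m) (hmb : m ≤ b) :
    ∃ s t : ℝ, 0 ≤ s ∧ 0 ≤ t ∧ dir n m = (s : ℂ) * dir n a + (t : ℂ) * dir n b := by
  have hn : 0 < n := by omega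
  have hd : 0 < (dir n (b - a)).im := dir_im_pos (by omega) (by omega)
  obtain ⟨s, t, h, hs, ht⟩ := exists_coeff hab hba (dir n m)
  refine ⟨s, t, ?_, ?_, h⟩
  · rw [hs, dir_neg_mul_dir, ← dir_neg_im, neg_sub]
    exact div_nonneg (dir_im_nonneg hn (by omega) (by omega)) hd.le
  · rw [ht, dir_neg_mul_dir]
    exact div_nonneg (dir_im_nonneg hn (by omega) (by omega)) hd.le

/-- The two sines are nonnegative and could vanish only at D = 0 and at D + 1 = n respectively,
which n ≥ 2 keeps apart. Thus the middle of a sector is strictly on one side of a line along a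
direction. -/
theorem dir_im_add_pos {n : ℕ} (hn : 2 ≤ n) {D : ℤ} (h0 : 0 ≤ D) (h1 : D < n) :
    0 < (dir n D).im + (dir n (D + 1)).im := by
  rcases h0.eq_or_lt with rfl | h
  · have := dir_im_pos (n := n) (a := 0 + 1) (by omega) (by omega)
    have := dir_im_nonneg (n := n) (a := 0) (by omega) (by omega) (by omega)
    linarith
  · have := dir_im_pos (n := n) h h1
    have := dir_im_nonneg (n := n) (a := D + 1) (by omega) (by omega) (by omega)
    linarith

/-! ### Rhombuses and their corners -/

theorem rhombus_add_period {n : ℕ} (hn : 0 < n) (z : ℂ) (a b l : ℤ) :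
    rhombus n z (a + 2 * n * l) (b + 2 * n * l) = rhombus n z a b := by
  unfold rhombus
  rw [dir_add_period hn, dir_add_period hn]

theorem rhombus_next {n : ℕ} (hn : 0 < n) (x : ℂ) (a b : ℤ) :
    rhombus n (x + dir n a) b (a + n) = rhombus n x a b := by
  ext z
  constructor
  · rintro ⟨s, hs, t, ht, rfl⟩
    refine ⟨1 - t, ⟨by linarith [ht.2], by linarith [ht.1]⟩, s, hs, ?_⟩
    rw [dir_add_n hn]
    push_cast
    ring
  · rintro ⟨s, hs, t, ht, rfl⟩
    refine ⟨t, ht, 1 - s, ⟨by linarith [hs.2], by linarith [hs.1]⟩, ?_⟩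
    rw [dir_add_n hn]
    push_cast
    ring

theorem rhombus_opposite {n : ℕ} (hn : 0 < n) (x : ℂ) (a b : ℤ) :
    rhombus n (x + dir n a + dir n b) (a + n) (b + n) = rhombus n x a b := by
  rw [rhombus_next hn, rhombus_next hn]

theorem rhombus_prev {n : ℕ} (hn : 0 < n) (x : ℂ) (a b : ℤ) :
    rhombus n (x + dir n b) (b + n) (a + 2 * n) = rhombus n x a b := by
  have h := (rhombus_next hn (x + dir n a + dir n b) (a + n) (b + n)).trans
    (rhombus_opposite hn x a b)
  rw [dir_add_n hn] at h
  rw [← h]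
  congr 1 <;> ring

theorem apex_mem_rhombus (n : ℕ) (z : ℂ) (a b : ℤ) : z ∈ rhombus n z a b :=
  ⟨0, by simp, 0, by simp, by simp⟩

theorem isClosed_rhombus (n : ℕ) (z : ℂ) (a b : ℤ) : IsClosed (rhombus n z a b) := by
  have h : rhombus n z a b = (fun q : ℝ × ℝ => z + (q.1 : ℂ) * dir n a + (q.2 : ℂ) * dir n b) ''
      (Set.Icc (0 : ℝ) 1 ×ˢ Set.Icc (0 : ℝ) 1) := by
    ext w
    constructor
    · rintro ⟨s, hs, t, ht, rfl⟩
      exact ⟨(s, t), ⟨hs, ht⟩, rfl⟩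
    · rintro ⟨⟨s, t⟩, ⟨hs, ht⟩, rfl⟩
      exact ⟨s, hs, t, ht, rfl⟩
  rw [h]
  exact ((isCompact_Icc.prod isCompact_Icc).image (by fun_prop)).isClosed

theorem Prototile.corner_bounds {n : ℕ} (p : Prototile n) {c : ℂ} {a b : ℤ}
    (h : (c, a, b) ∈ p.corners) : a < b ∧ b < a + n := by
  have h1 := p.i_lt_j
  have h2 := p.j_lt_n
  simp only [Prototile.corners, List.mem_cons, Prod.mk.injEq, List.not_mem_nil, or_false] at h
  omega

theorem tile_eq_rhombus {n : ℕ} (x : ℂ) (p : Prototile n) {c : ℂ} {a b : ℤ}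
    (h : (c, a, b) ∈ p.corners) : tile n x p = rhombus n (x + c) a b := by
  have h1 := p.i_lt_j
  have h2 := p.j_lt_n
  have hn : 0 < n := by omega
  simp only [Prototile.corners, List.mem_cons, Prod.mk.injEq, List.not_mem_nil, or_false] at h
  unfold tile
  rcases h with ⟨rfl, rfl, rfl⟩ | ⟨rfl, rfl, rfl⟩ | ⟨rfl, rfl, rfl⟩ | ⟨rfl, rfl, rfl⟩
  · rw [add_zero]
  · rw [rhombus_next hn]
  · rw [← add_assoc, rhombus_opposite hn]
  · rw [rhombus_prev hn]

/-- Every rhombus is a tile, with a corner at its apex. -/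
theorem exists_corner {n : ℕ} (z : ℂ) {a b : ℤ} (hab : a < b) (hba : b < a + n) :
    ∃ (x : ℂ) (p : Prototile n) (c : ℂ) (l : ℤ),
      (c, a + 2 * n * l, b + 2 * n * l) ∈ p.corners ∧ x + c = z := by
  have hn : 0 < n := by omega
  have hn' : (0 : ℤ) < 2 * n := by omega
  have h0 := Int.emod_nonneg a hn'.ne'
  have h1 := Int.emod_lt_of_pos a hn'
  have h2 := Int.emod_add_mul_ediv a (2 * n)
  set Q := a / (2 * n) with hQ
  set r := a % (2 * n) with hr
  suffices H : ∃ (p : Prototile n) (c : ℂ), (c, r, b - 2 * n * Q) ∈ p.corners by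
    obtain ⟨p, c, hc⟩ := H
    refine ⟨z - c, p, c, -Q, ?_, by ring⟩
    have e1 : a + 2 * n * -Q = r := by linarith
    have e2 : b + 2 * n * -Q = b - 2 * n * Q := by ring
    rwa [e1, e2]
  have hB : r < b - 2 * n * Q ∧ b - 2 * n * Q < r + n := by constructor <;> linarith
  generalize b - 2 * n * Q = B at hB
  clear_value r
  obtain ⟨hB1, hB2⟩ := hB
  lift r to ℕ using h0
  lift B to ℕ using by omega
  simp only [Prototile.corners, List.mem_cons, Prod.mk.injEq, List.not_mem_nil, or_false]
  -- With `r` in [0, 2n) and `B` in (r, r + n), comparing `r` with n and `B` with n or 2n separates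
  -- the four corners of the prototile.
  by_cases c1 : r < n
  · by_cases c2 : B < n
    · exact ⟨⟨r, B, by omega, c2⟩, 0, Or.inl ⟨rfl, rfl, rfl⟩⟩
    · exact ⟨⟨B - n, r, by omega, c1⟩, _, Or.inr (Or.inl ⟨rfl, rfl, by dsimp only; omega⟩)⟩
  · by_cases c2 : B < 2 * n
    · exact ⟨⟨r - n, B - n, by omega, by omega⟩, _, Or.inr (Or.inr (Or.inl
        ⟨rfl, by dsimp only; omega, by dsimp only; omega⟩))⟩
    · exact ⟨⟨B - 2 * n, r - n, by omega, by omega⟩, _, Or.inr (Or.inr (Or.inr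
        ⟨rfl, by dsimp only; omega, by dsimp only; omega⟩))⟩

theorem isTile_rhombus {n : ℕ} (z : ℂ) {a b : ℤ} (hab : a < b) (hba : b < a + n) :
    IsTile n (rhombus n z a b) ∧ IsVertex n (rhombus n z a b) z := by
  obtain ⟨x, p, c, l, hc, rfl⟩ := exists_corner z hab hba
  have h := tile_eq_rhombus x p hc
  rw [rhombus_add_period (by omega)] at h
  exact ⟨⟨x, p, h.symm⟩, x, p, h.symm, _, hc, rfl⟩

theorem isEdge_rhombus {n : ℕ} (z : ℂ) {a b : ℤ} (hab : a < b) (hba : b < a + n) :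
    IsEdge n (rhombus n z a b) (segment ℝ z (z + dir n a)) ∧
      IsEdge n (rhombus n z a b) (segment ℝ z (z + dir n b)) := by
  have hn : 0 < n := by omega
  obtain ⟨x, p, c, l, hc, rfl⟩ := exists_corner z hab hba
  have h := tile_eq_rhombus x p hc
  rw [rhombus_add_period hn] at h
  rw [← h, ← dir_add_period hn a l, ← dir_add_period hn b l]
  generalize a + 2 * n * l = A at hc
  generalize b + 2 * n * l = B at hc
  simp only [Prototile.corners, List.mem_cons, Prod.mk.injEq, List.not_mem_nil, or_false] at hc
  have h2 : ∀ a : ℤ, dir n (a + 2 * n) = dir n a := fun a => by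
    simpa using dir_add_period hn a 1
  have key : ∀ d : ℂ, (∃ k ∈ p.edges, segment ℝ (x + c) (x + c + d) =
      segment ℝ (x + k.1) (x + k.1 + dir n k.2)) →
      IsEdge n (tile n x p) (segment ℝ (x + c) (x + c + d)) := fun d hd => ⟨x, p, rfl, hd⟩
  have flip : ∀ y d : ℂ, segment ℝ (y + d) (y + d + -d) = segment ℝ y (y + d) := fun y d => by
    rw [segment_symm, add_neg_cancel_right]
  have flip' : ∀ y d e : ℂ, segment ℝ (y + (d + e)) (y + (d + e) + -d) =
      segment ℝ (y + e) (y + e + d) := fun y d e => by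
    rw [← flip (y + e) d]
    congr 1 <;> ring
  constructor <;> apply key <;> simp only [Prototile.edges, List.mem_cons, List.not_mem_nil,
    or_false, exists_eq_or_imp, exists_eq_left, add_zero] <;>
    rcases hc with ⟨rfl, rfl, rfl⟩ | ⟨rfl, rfl, rfl⟩ | ⟨rfl, rfl, rfl⟩ | ⟨rfl, rfl, rfl⟩ <;>
    simp only [dir_add_n hn, h2, flip, flip', add_zero, true_or, or_true]
  rw [add_comm (dir n p.i), flip']
  simp only [or_true]

theorem exists_rhombus_of_isVertex {n : ℕ} {t : Set ℂ} {z : ℂ} (h : IsVertex n t z) :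
    ∃ a b : ℤ, a < b ∧ b < a + n ∧ t = rhombus n z a b := by
  obtain ⟨x, p, rfl, ⟨c, a, b⟩, hk, rfl⟩ := h
  exact ⟨a, b, (p.corner_bounds hk).1, (p.corner_bounds hk).2, tile_eq_rhombus x p hk⟩

theorem exists_segment_of_isEdge {n : ℕ} {t e : Set ℂ} (h : IsEdge n t e) :
    ∃ (y : ℂ) (a : ℤ), IsVertex n t y ∧ IsVertex n t (y + dir n a) ∧
      e = segment ℝ y (y + dir n a) := by
  obtain ⟨x, p, rfl, ⟨c, a⟩, hk, rfl⟩ := h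
  refine ⟨x + c, a, ⟨x, p, rfl, ?_⟩, ⟨x, p, rfl, ?_⟩, rfl⟩ <;>
  · simp only [Prototile.edges, List.mem_cons, Prod.mk.injEq, List.not_mem_nil, or_false] at hk
    rcases hk with ⟨rfl, rfl⟩ | ⟨rfl, rfl⟩ | ⟨rfl, rfl⟩ | ⟨rfl, rfl⟩ <;>
    simp [Prototile.corners, add_assoc, add_comm (dir n p.j)]

/-! ### Sectors at a vertex -/

open Filter Topology in
theorem eventually_mem_rhombus (n : ℕ) (z : ℂ) (a b : ℤ) {s t : ℝ} (hs : 0 ≤ s) (ht : 0 ≤ t) :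
    ∀ᶠ ε : ℝ in 𝓝[>] 0, z + ε * (s * dir n a + t * dir n b) ∈ rhombus n z a b := by
  have key : ∀ r : ℝ, ∀ᶠ ε : ℝ in 𝓝[>] 0, ε * r < 1 := fun r => by
    have h : Tendsto (fun ε : ℝ => ε * r) (𝓝 0) (𝓝 0) := by
      have : Continuous fun ε : ℝ => ε * r := by fun_prop
      simpa using this.tendsto 0
    exact (h.mono_left nhdsWithin_le_nhds).eventually_lt_const one_pos
  filter_upwards [key s, key t, self_mem_nhdsWithin] with ε h1 h2 h3
  have h3' : (0 : ℝ) < ε := h3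
  refine ⟨ε * s, ⟨by positivity, h1.le⟩, ε * t, ⟨by positivity, h2.le⟩, ?_⟩
  push_cast
  ring

open Filter Topology in
theorem eventually_dir_mem {n : ℕ} (z : ℂ) {a b m : ℤ} (hab : a < b) (hba : b < a + n)
    (ham : a ≤ m) (hmb : m ≤ b) : ∀ᶠ ε : ℝ in 𝓝[>] 0, z + ε * dir n m ∈ rhombus n z a b := by
  obtain ⟨s, t, hs, ht, h⟩ := exists_coeff_dir hab hba ham hmb
  rw [h]
  exact eventually_mem_rhombus n z a b hs ht

open Filter Topology in
-- The bisector v_m + v_{m+1} serves as a test direction for sector m: being interior to the sector,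
-- it detects which tile covers it. The converse is `sector_of_mem`.
theorem eventually_sector_mem {n : ℕ} (z : ℂ) {a b m : ℤ} (hab : a < b) (hba : b < a + n)
    (ham : a ≤ m) (hmb : m < b) :
    ∀ᶠ ε : ℝ in 𝓝[>] 0, z + ε * (dir n m + dir n (m + 1)) ∈ rhombus n z a b := by
  obtain ⟨s, t, hs, ht, h⟩ := exists_coeff_dir hab hba ham hmb.le
  obtain ⟨s', t', hs', ht', h'⟩ := exists_coeff_dir (m := m + 1) hab hba (by omega) hmb
  have e : dir n m + dir n (m + 1) = (s + s' : ℝ) * dir n a + (t + t' : ℝ) * dir n b := by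
    rw [h, h']
    push_cast
    ring
  rw [e]
  exact eventually_mem_rhombus n z a b (by positivity) (by positivity)

/-- A rhombus that meets the middle of a sector near its apex contains that sector. -/
theorem sector_of_mem {n : ℕ} (hn : 2 ≤ n) {z : ℂ} {a b m : ℤ} (hab : a < b) (hba : b < a + n)
    {ε : ℝ} (hε : 0 < ε) (h : z + ε * (dir n m + dir n (m + 1)) ∈ rhombus n z a b) :
    ∃ l : ℤ, a ≤ m + 2 * n * l ∧ m + 2 * n * l < b := by
  have hn0 : 0 < n := by omega
  obtain ⟨l, h0, h1⟩ : ∃ l : ℤ, 0 ≤ m + 2 * n * l - a ∧ m + 2 * n * l - a < 2 * n := by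
    have hn' : (0 : ℤ) < 2 * n := by omega
    have h0 := Int.emod_nonneg (m - a) hn'.ne'
    have h1 := Int.emod_lt_of_pos (m - a) hn'
    have h2 := Int.emod_add_mul_ediv (m - a) (2 * n)
    exact ⟨-((m - a) / (2 * n)), by linarith, by linarith⟩
  refine ⟨l, by omega, ?_⟩
  rw [← dir_add_period hn0 m l, ← dir_add_period hn0 (m + 1) l] at h
  rw [show m + 1 + 2 * n * l = m + 2 * n * l + 1 by ring] at h
  generalize m + 2 * n * l = M at *
  obtain ⟨s, hs, t, ht, e⟩ := h
  have e' : (ε : ℂ) * dir n M + (ε : ℂ) * dir n (M + 1) = (s : ℂ) * dir n a + (t : ℂ) * dir n b := by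
    linear_combination e
  have ea := congrArg (fun w => (dir n (-a) * w).im) e'
  have eb := congrArg (fun w => (dir n (-b) * w).im) e'
  simp only [rotate_im] at ea eb
  rw [show a - b = -(b - a) by ring, dir_neg_im] at eb
  simp only [sub_self, dir_zero, Complex.one_im, mul_zero, zero_add, add_zero] at ea eb
  have hd : 0 < (dir n (b - a)).im := dir_im_pos (by omega) (by omega)
  -- Beyond a half turn from v_a, the test point would be strictly on the wrong side of the line
  -- along v_a; past v_b, on the wrong side of the line along v_b.
  have hMn : M - a < n := by
    by_contra! hc
    have := dir_im_add_pos hn (D := M - a - n) (by omega) (by omega)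
    have e1 := dir_add_n_im hn0 (M - a - n)
    have e2 := dir_add_n_im hn0 (M - a - n + 1)
    rw [show M - a - n + n = M - a by ring] at e1
    rw [show M - a - n + 1 + n = M + 1 - a by ring] at e2
    nlinarith [mul_pos hε this, mul_nonneg ht.1 hd.le]
  by_contra! hc
  have := dir_im_add_pos hn (D := M - b) (by omega) (by omega)
  rw [show M - b + 1 = M + 1 - b by ring] at this
  nlinarith [mul_pos hε this, mul_nonneg hs.1 hd.le]

/-- The apex is an extreme point of the rhombus. -/
theorem apex_eq_of_mem_segment {n : ℕ} {z : ℂ} {a b : ℤ} (hab : a < b) (hba : b < a + n) {p q : ℂ}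
    (hp : p ∈ rhombus n z a b) (hq : q ∈ rhombus n z a b) (h : z ∈ segment ℝ p q) :
    z = p ∨ z = q := by
  obtain ⟨α, β, hα, hβ, hαβ, e⟩ := h
  rcases hα.eq_or_lt with rfl | hα
  · right
    rw [zero_add] at hαβ
    rw [← e, hαβ, zero_smul, zero_add, one_smul]
  left
  obtain ⟨s, hs, t, ht, rfl⟩ := hp
  obtain ⟨s', hs', t', ht', rfl⟩ := hq
  have e' : ((α * s + β * s' : ℝ) : ℂ) * dir n a + ((α * t + β * t' : ℝ) : ℂ) * dir n b = 0 := by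
    have hαβ' : (α : ℂ) + β = 1 := by exact_mod_cast hαβ
    simp only [Complex.real_smul] at e
    push_cast
    linear_combination e - z * hαβ'
  obtain ⟨h1, h2⟩ := coeff_eq_zero hab hba e'
  have hs0 : s = 0 := by
    have : α * s = 0 := by nlinarith [mul_nonneg hα.le hs.1, mul_nonneg hβ hs'.1]
    exact (mul_eq_zero.1 this).resolve_left hα.ne'
  have ht0 : t = 0 := by
    have : α * t = 0 := by nlinarith [mul_nonneg hα.le ht.1, mul_nonneg hβ ht'.1]
    exact (mul_eq_zero.1 this).resolve_left hα.ne'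
  simp [hs0, ht0]

/-- In an edge-to-edge set, a tile that contains a vertex of another tile has a corner there. -/
theorem EdgeToEdge.exists_rhombus {n : ℕ} {P : Set (Set ℂ)} (hP : EdgeToEdge n P) {s t : Set ℂ}
    (hs : s ∈ P) (ht : t ∈ P) {z : ℂ} (hz : IsVertex n s z) (hzt : z ∈ t) :
    ∃ a b : ℤ, a < b ∧ b < a + n ∧ t = rhombus n z a b := by
  by_cases hst : s = t
  · exact exists_rhombus_of_isVertex (hst ▸ hz)
  obtain ⟨a, b, hab, hba, rfl⟩ := exists_rhombus_of_isVertex hz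
  have hmem : z ∈ rhombus n z a b ∩ t := ⟨apex_mem_rhombus n z a b, hzt⟩
  rcases hP.2 _ hs t ht hst with h | ⟨y, -, hy, h⟩ | ⟨e, -, he, h⟩
  · rw [h] at hmem
    exact hmem.elim
  · rw [h, Set.mem_singleton_iff] at hmem
    exact exists_rhombus_of_isVertex (hmem ▸ hy)
  · obtain ⟨y, d, h1, h2, rfl⟩ := exists_segment_of_isEdge he
    have hsub : segment ℝ y (y + dir n d) ⊆ rhombus n z a b := h ▸ Set.inter_subset_left
    rw [h] at hmem
    rcases apex_eq_of_mem_segment hab hba (hsub (left_mem_segment ℝ _ _))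
      (hsub (right_mem_segment ℝ _ _)) hmem with rfl | rfl
    · exact exists_rhombus_of_isVertex h1
    · exact exists_rhombus_of_isVertex h2

/-- In an edge-to-edge set, two tiles with a common sector at a common vertex are equal. -/
theorem EdgeToEdge.rhombus_eq {n : ℕ} {P : Set (Set ℂ)} (hP : EdgeToEdge n P) {z : ℂ}
    {a b A B m : ℤ} (hab : a < b) (hba : b < a + n) (hAB : A < B) (hBA : B < A + n)
    (h1 : rhombus n z a b ∈ P) (h2 : rhombus n z A B ∈ P)
    (ham : a ≤ m) (hmb : m < b) (hAm : A ≤ m) (hmB : m < B) :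
    rhombus n z a b = rhombus n z A B := by
  by_contra hne
  -- The points z, z + εv_m and z + εv_{m+1} all lie in the intersection. They are not collinear, so
  -- the intersection is neither a vertex nor an edge.
  obtain ⟨ε, ⟨⟨⟨h3, h4⟩, h5⟩, h6⟩, hε⟩ := ((((eventually_dir_mem z hab hba ham hmb.le).and
    (eventually_dir_mem z hAB hBA hAm hmB.le)).and
    (eventually_dir_mem z hab hba (show a ≤ m + 1 by omega) hmb)).and
    (eventually_dir_mem z hAB hBA (show A ≤ m + 1 by omega) hmB)).and
    self_mem_nhdsWithin |>.exists
  have hε' : (ε : ℂ) ≠ 0 := by exact_mod_cast (ne_of_gt hε : ε ≠ 0)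
  have k0 : z ∈ rhombus n z a b ∩ rhombus n z A B := ⟨apex_mem_rhombus .., apex_mem_rhombus ..⟩
  have k1 := Set.mem_inter h3 h4
  have k2 := Set.mem_inter h5 h6
  rcases hP.2 _ h1 _ h2 hne with h | ⟨y, -, -, h⟩ | ⟨e, -, he, h⟩
  · rw [h] at k0
    exact k0
  · rw [h, Set.mem_singleton_iff] at k0 k1
    rw [← k0, add_eq_left] at k1
    exact mul_ne_zero hε' (dir_ne_zero n m) k1
  · obtain ⟨y, d, -, -, rfl⟩ := exists_segment_of_isEdge he
    have seg : ∀ w ∈ segment ℝ y (y + dir n d), ∃ r : ℝ, w = y + r * dir n d := by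
      rintro w ⟨α, β, -, -, hαβ, rfl⟩
      have hαβ' : (α : ℂ) + β = 1 := by exact_mod_cast hαβ
      refine ⟨β, ?_⟩
      simp only [Complex.real_smul]
      linear_combination y * hαβ'
    rw [h] at k0 k1 k2
    obtain ⟨r0, e0⟩ := seg _ k0
    obtain ⟨r1, e1⟩ := seg _ k1
    obtain ⟨r2, e2⟩ := seg _ k2
    have e3 : (((r2 - r0) * ε : ℝ) : ℂ) * dir n m + ((-((r1 - r0) * ε) : ℝ) : ℂ) * dir n (m + 1)
        = 0 := by
      push_cast
      linear_combination (r2 - r0 : ℂ) * e1 - (r1 - r0 : ℂ) * e2 + (r1 - r2 : ℂ) * e0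
    have e4 := (coeff_eq_zero (by omega) (by omega) e3).1
    have e5 : r2 = r0 := by
      rcases mul_eq_zero.1 e4 with h | h
      · linarith
      · exact absurd h (ne_of_gt hε)
    rw [e5, ← e0, add_eq_left] at e2
    exact mul_ne_zero hε' (dir_ne_zero n (m + 1)) e2

open Filter Topology in
-- Otherwise each member misses the ray near z, either since it is closed and avoids z or by
-- assumption; finitely many such conditions hold at once.
theorem exists_mem_of_eventually_mem_sUnion {P : Set (Set ℂ)} (hP : P.Finite)
    (hc : ∀ s ∈ P, IsClosed s) {z w : ℂ} (h : ∀ᶠ ε : ℝ in 𝓝[>] 0, z + ε * w ∈ ⋃₀ P) :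
    ∃ s ∈ P, z ∈ s ∧ ∃ ε : ℝ, 0 < ε ∧ z + ε * w ∈ s := by
  by_contra! H
  have h' : ∀ s ∈ P, ∀ᶠ ε : ℝ in 𝓝[>] 0, z + ε * w ∉ s := by
    intro s hs
    by_cases hz : z ∈ s
    · filter_upwards [self_mem_nhdsWithin] with ε hε using H s hs hz ε hε
    · have ht : Tendsto (fun ε : ℝ => z + ε * w) (𝓝 0) (𝓝 z) := by
        have : Continuous fun ε : ℝ => z + ε * w := by fun_prop
        simpa using this.tendsto 0
      exact (ht.mono_left nhdsWithin_le_nhds).eventually ((hc s hs).isOpen_compl.mem_nhds hz)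
  obtain ⟨ε, ⟨s, hs, hm⟩, h2⟩ := (h.and ((eventually_all_finite hP).2 h')).exists
  exact h2 s hs hm

open Filter Topology in
/-- A sector covered by a finite edge-to-edge set near one of its vertices lies in the corner of
one tile. -/
theorem EdgeToEdge.exists_corner {n : ℕ} (hn : 2 ≤ n) {P : Set (Set ℂ)} (hP : EdgeToEdge n P)
    (hfin : P.Finite) {s : Set ℂ} (hs : s ∈ P) {z : ℂ} (hz : IsVertex n s z) (m : ℤ)
    (h : ∀ᶠ ε : ℝ in 𝓝[>] 0, z + ε * (dir n m + dir n (m + 1)) ∈ ⋃₀ P) :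
    ∃ a b : ℤ, a ≤ m ∧ m < b ∧ b < a + n ∧ rhombus n z a b ∈ P := by
  have hc : ∀ t ∈ P, IsClosed t := fun t ht => by
    obtain ⟨x, p, rfl⟩ := hP.1 t ht
    exact isClosed_rhombus ..
  obtain ⟨t, ht, hzt, ε, hε, hm⟩ := exists_mem_of_eventually_mem_sUnion hfin hc h
  obtain ⟨a, b, hab, hba, rfl⟩ := hP.exists_rhombus hs ht hz hzt
  obtain ⟨l, h1, h2⟩ := sector_of_mem hn hab hba hε hm
  refine ⟨a + 2 * n * (-l), b + 2 * n * (-l), by linarith, by linarith, by linarith, ?_⟩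
  rwa [rhombus_add_period (by omega)]

/-! ### The expansion factor -/

theorem cos_pos_of_lt_half {n i : ℕ} (hi : i < n / 2) :
    0 < Real.cos ((i : ℝ) * Real.pi / (n : ℝ)) := by
  have hn : (0 : ℝ) < n := by exact_mod_cast (by omega : 0 < n)
  have hi' : 2 * (i : ℝ) < n := by exact_mod_cast (by omega : 2 * i < n)
  have := Real.pi_pos
  apply Real.cos_pos_of_mem_Ioo
  constructor
  · have : 0 ≤ (i : ℝ) * Real.pi / n := by positivity
    linarith
  · rw [div_lt_iff₀ hn]
    nlinarith

theorem letterLength_billiardWord_nonneg (n m : ℕ) : 0 ≤ letterLength n (billiardWord n m) := by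
  unfold letterLength
  split_ifs with h
  · exact zero_le_one
  · unfold billiardWord at h ⊢
    rw [Nat.mul_div_cancel_left _ two_pos]
    -- `sInf ∅ = 0` would give the letter 0, already treated, so no existence of crossings has to be
    -- proved.
    rcases Set.eq_empty_or_nonempty {i : ℕ | Crosses n (crossingTime n (m + 1)) i} with he | he
    · rw [he] at h
      simp at h
    · have := cos_pos_of_lt_half (Nat.sInf_mem he).1
      positivity

/-- All coordinates start at 1/2 and increase with speed at most 1, so none reaches 1 before x_0,
whose speed is exactly 1. -/
theorem crossingTime_one {n : ℕ} (hn : 2 ≤ n) : crossingTime n 1 = 1 / 2 := by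
  have hleast : IsLeast {t : ℝ | crossingTime n 0 < t ∧ ∃ i, Crosses n t i} (1 / 2) := by
    constructor
    · refine ⟨by norm_num [crossingTime], 0, by omega, 1, by norm_num⟩
    · rintro t ⟨ht, i, hi, k, hk⟩
      simp only [crossingTime] at ht
      have hc := cos_pos_of_lt_half hi
      have hc1 := Real.cos_le_one ((i : ℝ) * Real.pi / (n : ℝ))
      have hk0 : 0 < k := by
        have : (0 : ℝ) < k := by rw [← hk]; positivity
        exact_mod_cast this
      have hk1 : (1 : ℝ) ≤ k := by exact_mod_cast hk0
      nlinarith [mul_le_mul_of_nonneg_left hc1 ht.le]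
  exact hleast.csInf_eq

theorem billiardWord_zero {n : ℕ} (hn : 2 ≤ n) : billiardWord n 0 = 0 := by
  have h : Crosses n (crossingTime n 1) 0 := by
    rw [crossingTime_one hn]
    exact ⟨by omega, 1, by norm_num⟩
  have := Nat.sInf_le (s := {i : ℕ | Crosses n (crossingTime n (0 + 1)) i}) h
  unfold billiardWord
  omega

theorem two_le_factor {n i : ℕ} (hn : 2 ≤ n) (hi : i ≠ 0) : 2 ≤ factor n (candidateWord n i) := by
  obtain ⟨i, rfl⟩ := Nat.exists_eq_succ_of_ne_zero hi
  have h : factor n (candidateWord n (i + 1)) =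
      2 * (((List.range (i + 1)).map (billiardWord n)).map (letterLength n)).sum := by
    rw [factor, candidateWord, List.map_append, List.sum_append, List.map_reverse,
      List.sum_reverse, two_mul]
  have h0 : letterLength n (billiardWord n 0) = 1 := by simp [billiardWord_zero hn, letterLength]
  rw [Nat.succ_eq_add_one, h, List.range_succ_eq_map, List.map_cons, List.map_cons, List.sum_cons,
    h0]
  have : 0 ≤ (List.map (letterLength n) (List.map (billiardWord n)
      (List.map Nat.succ (List.range i)))).sum := by
    apply List.sum_nonneg
    simp only [List.map_map, List.mem_map]
    rintro _ ⟨m, -, rfl⟩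
    exact letterLength_billiardWord_nonneg n _
  linarith

/-- The corner condition excludes the empty edgeword. -/
theorem Substitution.CornerCondition.ne_zero {n i : ℕ} (hn : 2 ≤ n)
    {σ : Substitution n (candidateWord n i)} (hσ : σ.CornerCondition) : i ≠ 0 := by
  rintro rfl
  let p : Prototile n := ⟨0, 1, one_pos, by omega⟩
  have h := (hσ p (0, (p.i : ℤ), (p.j : ℤ)) (by simp [Prototile.corners])).1
  -- With μ = 0 and no boundary rhombuses the metatile would cover only the point 0, yet its corner
  -- rhombus contains v_i.
  have hf : factor n (candidateWord n 0) = 0 := by simp [factor, candidateWord]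
  have hmem : dir n p.i ∈ ⋃₀ σ.metatile p :=
    ⟨_, h, 1, by simp, 0, by simp, by simp⟩
  rw [σ.covers p, hf] at hmem
  rcases hmem with ⟨z, -, hz⟩ | ⟨s, ⟨k, -, hk⟩, -⟩
  · exact dir_ne_zero n p.i (by simpa using hz.symm)
  · simp [candidateWord, edgeTiles] at hk

/-! ### Corners of metatiles -/

section Metatiles

variable {n : ℕ} {u : List ℕ} (σ : Substitution n u)

theorem mem_sUnion_metatile (hμ : 0 < factor n u) (p : Prototile n) {s t : ℝ}
    (hs : s ∈ Set.Icc 0 (factor n u)) (ht : t ∈ Set.Icc 0 (factor n u)) :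
    (s : ℂ) * dir n p.i + (t : ℂ) * dir n p.j ∈ ⋃₀ σ.metatile p := by
  rw [σ.covers p]
  left
  have hμ' : (factor n u : ℂ) ≠ 0 := by exact_mod_cast hμ.ne'
  refine ⟨_, ⟨s / factor n u, ⟨div_nonneg hs.1 hμ.le, (div_le_one hμ).2 hs.2⟩,
    t / factor n u, ⟨div_nonneg ht.1 hμ.le, (div_le_one hμ).2 ht.2⟩, rfl⟩, ?_⟩
  push_cast
  field_simp
  ring

theorem rhombus_subset_sUnion_metatile (hμ : 1 ≤ factor n u) (p : Prototile n) {c : ℂ} {a b : ℤ}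
    (h : (c, a, b) ∈ p.corners) : rhombus n (factor n u * c) a b ⊆ ⋃₀ σ.metatile p := by
  rw [σ.covers p, tile_eq_rhombus 0 p h]
  rintro _ ⟨s, hs, t, ht, rfl⟩
  left
  have hμ0 : 0 < factor n u := by linarith
  have hμ' : (factor n u : ℂ) ≠ 0 := by exact_mod_cast hμ0.ne'
  refine ⟨_, ⟨s / factor n u, ⟨div_nonneg hs.1 hμ0.le, (div_le_one hμ0).2 (hs.2.trans hμ)⟩,
    t / factor n u, ⟨div_nonneg ht.1 hμ0.le, (div_le_one hμ0).2 (ht.2.trans hμ)⟩, rfl⟩, ?_⟩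
  push_cast
  field_simp
  ring

/-- In a corner of a metatile the two narrow rhombuses take up one sector at either side, and the
tiles between them are at least two sectors narrower than the corner. -/
theorem exists_narrower_corner (hn : 2 ≤ n) (hμ : 1 ≤ factor n u) (hσ : σ.CornerCondition)
    (p : Prototile n) {c : ℂ} {a b m : ℤ} (h : (c, a, b) ∈ p.corners) (ham : a ≤ m) (hmb : m < b) :
    ∃ A B : ℤ, A ≤ m ∧ m < B ∧ B < A + n ∧ B - A ≤ max 1 (b - a - 2) ∧
      rhombus n (factor n u * c) A B ∈ σ.metatile p := by
  obtain ⟨hab, hba⟩ := p.corner_bounds h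
  obtain ⟨hl, hr⟩ := hσ p _ h
  dsimp only at hl hr
  rcases ham.eq_or_lt with rfl | ham'
  · exact ⟨a, a + 1, le_rfl, by omega, by omega, by omega, hl⟩
  by_cases hm : m = b - 1
  · exact ⟨b - 1, b, by omega, by omega, by omega, by omega, hr⟩
  obtain ⟨A, B, hA, hB, hBA, hmem⟩ := (σ.edgeToEdge p).exists_corner hn (σ.finite p) hl
    (isTile_rhombus _ (by omega) (by omega)).2 m
    ((eventually_sector_mem _ hab hba ham hmb).mono
      fun ε hε => rhombus_subset_sUnion_metatile σ hμ p h hε)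
  obtain ⟨ε, hin, hε⟩ := ((eventually_sector_mem (factor n u * c) (by omega) hBA hA hB).and
    self_mem_nhdsWithin).exists
  -- A tile that covers m and also the sector d of a narrow rhombus would equal that rhombus, which
  -- covers no sector but d.
  have away : ∀ d : ℤ, a ≤ d → d < b → d ≠ m →
      rhombus n (factor n u * c) d (d + 1) ∈ σ.metatile p → ¬ (A ≤ d ∧ d < B) := by
    rintro d h1 h2 h3 h4 ⟨h5, h6⟩
    have e := (σ.edgeToEdge p).rhombus_eq (m := d) (by omega) hBA (by omega) (by omega) hmem h4
      h5 h6 le_rfl (by omega)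
    rw [e] at hin
    obtain ⟨l, h7, h8⟩ := sector_of_mem hn (by omega) (by omega) hε hin
    have h9 : m + 2 * n * l = d := by omega
    rcases lt_trichotomy l 0 with hl | rfl | hl
    · nlinarith
    · omega
    · nlinarith
  have h1 := away a le_rfl hab (by omega) hl
  have h2 := away (b - 1) (by omega) (by omega) (by omega) (by rwa [sub_add_cancel])
  -- Avoiding the sectors a and b - 1 while containing m forces a + 1 ≤ A and B ≤ b - 1.
  exact ⟨A, B, hA, hB, hBA, by omega, hmem⟩

theorem image_add_rhombus (x y : ℂ) (a b : ℤ) :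
    (fun z => x + z) '' rhombus n y a b = rhombus n (x + y) a b := by
  ext w
  constructor
  · rintro ⟨_, ⟨s, hs, t, ht, rfl⟩, rfl⟩
    exact ⟨s, hs, t, ht, by ring⟩
  · rintro ⟨s, hs, t, ht, rfl⟩
    exact ⟨_, ⟨s, hs, t, ht, rfl⟩, by ring⟩

theorem exists_narrower_apply (hn : 2 ≤ n) (hμ : 1 ≤ factor n u) (hσ : σ.CornerCondition)
    {P : Set (Set ℂ)} {z : ℂ} {a b m : ℤ} (hP : rhombus n z a b ∈ P) (hba : b < a + n)
    (ham : a ≤ m) (hmb : m < b) :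
    ∃ A B : ℤ, A ≤ m ∧ m < B ∧ B < A + n ∧ B - A ≤ max 1 (b - a - 2) ∧
      rhombus n (factor n u * z) A B ∈ σ.apply P := by
  have hn0 : 0 < n := by omega
  obtain ⟨x, p, c, l, hc, rfl⟩ := exists_corner z (by omega : a < b) hba
  obtain ⟨A, B, h1, h2, h3, h4, h5⟩ :=
    exists_narrower_corner σ hn hμ hσ p hc (m := m + 2 * n * l) (by omega) (by omega)
  refine ⟨A + 2 * n * (-l), B + 2 * n * (-l), by linarith, by linarith, by linarith, ?_, x, p, ?_,
    _, h5, ?_⟩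
  · have e1 : B + 2 * n * (-l) - (A + 2 * n * (-l)) = B - A := by ring
    have e2 : b + 2 * n * l - (a + 2 * n * l) - 2 = b - a - 2 := by ring
    rw [e1]
    rwa [e2] at h4
  · rw [tile_eq_rhombus x p hc, rhombus_add_period hn0]
    exact hP
  · dsimp only
    rw [image_add_rhombus, rhombus_add_period hn0, mul_add]

/-! ### Sine inequalities and a vertex interior to the metatile. -/

theorem dir_one_im_le {d : ℤ} (h1 : 1 ≤ d) (h2 : d < n) : (dir n 1).im ≤ (dir n d).im := by
  have hn : (0 : ℝ) < n := by exact_mod_cast (by omega : 0 < n)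
  have h1' : (1 : ℝ) ≤ d := by exact_mod_cast h1
  have h2' : (d : ℝ) + 1 ≤ n := by exact_mod_cast h2
  have hπ := Real.pi_pos
  rw [dir_im, dir_im, ← sub_nonneg, Real.sin_sub_sin]
  have hs : 0 ≤ Real.sin ((d * Real.pi / n - (1 : ℤ) * Real.pi / n) / 2) := by
    have e : (d * Real.pi / n - (1 : ℤ) * Real.pi / n) / 2 = (d - 1) * Real.pi / n / 2 := by
      push_cast
      ring
    rw [e]
    have h0 : 0 ≤ (d - 1) * Real.pi / n := div_nonneg (mul_nonneg (by linarith) hπ.le) hn.le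
    have h3 : (d - 1) * Real.pi / n ≤ Real.pi := by
      rw [div_le_iff₀ hn]
      nlinarith
    apply Real.sin_nonneg_of_nonneg_of_le_pi <;> linarith
  have hc : 0 ≤ Real.cos ((d * Real.pi / n + (1 : ℤ) * Real.pi / n) / 2) := by
    have e : (d * Real.pi / n + (1 : ℤ) * Real.pi / n) / 2 = (d + 1) * Real.pi / n / 2 := by
      push_cast
      ring
    rw [e]
    have h0 : 0 ≤ (d + 1) * Real.pi / n := by positivity
    have h3 : (d + 1) * Real.pi / n ≤ Real.pi := by
      rw [div_le_iff₀ hn]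
      nlinarith
    apply Real.cos_nonneg_of_neg_pi_div_two_le_of_le <;> linarith
  positivity

/-- With θ = π/n, sin((d - 1)θ) = sin dθ cos θ - cos dθ sin θ < sin dθ + sin θ ≤ 2 sin dθ. This
bounds a coordinate of the interior vertex by 2. -/
theorem dir_sub_one_im_lt {d : ℤ} (h1 : 1 ≤ d) (h2 : d < n) :
    (dir n (d - 1)).im < 2 * (dir n d).im := by
  have h3 := dir_one_im_le h1 h2
  have h4 : 0 < (dir n 1).im := dir_im_pos one_pos (by omega)
  have e : (dir n (d - 1)).im = (dir n d).im * (dir n 1).re - (dir n d).re * (dir n 1).im := by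
    rw [dir_im, dir_im, dir_re, dir_im, dir_re, ← Real.sin_sub]
    congr 1
    push_cast
    ring
  have hc : (dir n 1).re < 1 := by
    have h5 := Real.sin_sq_add_cos_sq ((1 : ℤ) * Real.pi / n)
    rw [← dir_im, ← dir_re] at h5
    nlinarith
  have hd : -1 ≤ (dir n d).re := by
    rw [dir_re]
    exact Real.neg_one_le_cos _
  nlinarith

open Filter Topology in
/-- A metatile has a vertex in the interior of the expanded prototile, and so with a full turn of
tiles around it. -/
theorem exists_interior_vertex (hn : 2 ≤ n) (hμ : 2 ≤ factor n u) (hσ : σ.CornerCondition)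
    (p : Prototile n) : ∃ z : ℂ, ∀ m : ℤ, ∃ a b : ℤ, a ≤ m ∧ m < b ∧ b < a + n ∧
      rhombus n z a b ∈ σ.metatile p := by
  have hij := p.i_lt_j
  have hjn := p.j_lt_n
  have hn0 : 0 < n := by omega
  have hab : (p.i : ℤ) < p.j := by omega
  have hba : (p.j : ℤ) < p.i + n := by omega
  have hnar := (hσ p (0, (p.i : ℤ), (p.j : ℤ)) (by simp [Prototile.corners])).1
  simp only [mul_zero] at hnar
  -- The vertex is v_i + v_j if the prototile is itself narrow, and v_{i+1} otherwise. Coordinates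
  -- in (0, 2) make it interior to the expanded prototile because μ ≥ 2.
  obtain ⟨α, β, hα0, hα1, hβ0, hβ1, hv⟩ : ∃ α β : ℝ, 0 < α ∧ α < 2 ∧ 0 < β ∧ β < 2 ∧
      IsVertex n (rhombus n 0 p.i (p.i + 1)) (α * dir n p.i + β * dir n p.j) := by
    by_cases hj : p.j = p.i + 1
    · refine ⟨1, 1, one_pos, one_lt_two, one_pos, one_lt_two, ?_⟩
      rw [← rhombus_opposite hn0, hj]
      simp only [zero_add, Complex.ofReal_one, one_mul, Nat.cast_add, Nat.cast_one]
      exact (isTile_rhombus _ (by omega) (by omega)).2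
    · obtain ⟨s, t, h, hs, ht⟩ := exists_coeff hab hba (dir n (p.i + 1))
      have hd : 0 < (dir n ((p.j : ℤ) - p.i)).im := dir_im_pos (by omega) (by omega)
      have e1 : s = (dir n ((p.j : ℤ) - p.i - 1)).im / (dir n ((p.j : ℤ) - p.i)).im := by
        rw [hs, dir_neg_mul_dir, ← dir_neg_im]
        congr 3
        ring
      have e2 : t = (dir n 1).im / (dir n ((p.j : ℤ) - p.i)).im := by
        rw [ht, dir_neg_mul_dir, add_sub_cancel_left]
      refine ⟨s, t, ?_, ?_, ?_, ?_, ?_⟩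
      · rw [e1]
        exact div_pos (dir_im_pos (by omega) (by omega)) hd
      · rw [e1, div_lt_iff₀ hd]
        exact dir_sub_one_im_lt (by omega) (by omega)
      · rw [e2]
        exact div_pos (dir_im_pos (by omega) (by omega)) hd
      · rw [e2, div_lt_iff₀ hd]
        have := dir_one_im_le (n := n) (d := (p.j : ℤ) - p.i) (by omega) (by omega)
        linarith
      · rw [← h, ← rhombus_prev hn0, zero_add]
        exact (isTile_rhombus _ (by omega) (by omega)).2
  refine ⟨_, fun m => (σ.edgeToEdge p).exists_corner hn (σ.finite p) hnar hv m ?_⟩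
  obtain ⟨s, t, h, -, -⟩ := exists_coeff hab hba (dir n m + dir n (m + 1))
  have key : ∀ x y : ℝ, 0 < x → x < 2 →
      ∀ᶠ ε : ℝ in 𝓝[>] 0, x + ε * y ∈ Set.Icc 0 (factor n u) := fun x y hx0 hx1 => by
    have hc : Tendsto (fun ε : ℝ => x + ε * y) (𝓝 0) (𝓝 x) := by
      have : Continuous fun ε : ℝ => x + ε * y := by fun_prop
      simpa using this.tendsto 0
    exact (hc.mono_left nhdsWithin_le_nhds).eventually (Icc_mem_nhds hx0 (by linarith))
  filter_upwards [key α s hα0 hα1, key β t hβ0 hβ1] with ε h1 h2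
  have := mem_sUnion_metatile σ (by linarith) p h1 h2
  rw [h]
  convert this using 1
  push_cast
  ring

/-! ### Iteration until all corners at a vertex are narrow. -/

theorem metatile_subset_iterate_one (p : Prototile n) : σ.metatile p ⊆ σ.iterate 1 p := by
  intro s hs
  exact ⟨0, p, rfl, s, hs, by simp⟩

theorem exists_narrow_iterate (hn : 2 ≤ n) (hμ : 2 ≤ factor n u) (hσ : σ.CornerCondition)
    (p : Prototile n) (k : ℕ) : ∃ z : ℂ, ∀ m : ℤ, ∃ a b : ℤ, a ≤ m ∧ m < b ∧ b < a + n ∧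
      b - a ≤ max 1 (n - 1 - 2 * k) ∧ rhombus n z a b ∈ σ.iterate (k + 1) p := by
  induction k with
  | zero =>
    obtain ⟨z, hz⟩ := exists_interior_vertex σ hn hμ hσ p
    refine ⟨z, fun m => ?_⟩
    obtain ⟨a, b, h1, h2, h3, h4⟩ := hz m
    exact ⟨a, b, h1, h2, h3, by omega, metatile_subset_iterate_one σ p h4⟩
  | succ k ih =>
    obtain ⟨z, hz⟩ := ih
    refine ⟨factor n u * z, fun m => ?_⟩
    obtain ⟨a, b, h1, h2, h3, h4, h5⟩ := hz m
    obtain ⟨A, B, h6, h7, h8, h9, h10⟩ :=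
      exists_narrower_apply σ hn (by linarith) hσ h5 h3 h1 h2
    refine ⟨A, B, h6, h7, h8, by omega, ?_⟩
    rw [Substitution.iterate, Function.iterate_succ_apply']
    exact h10

theorem star_appears (hn : 2 ≤ n) (heven : Even n) (hμ : 2 ≤ factor n u) (hσ : σ.CornerCondition)
    (p : Prototile n) : Appears (star n) (σ.iterate (n / 2 + 1) p) := by
  obtain ⟨z, hz⟩ := exists_narrow_iterate σ hn hμ hσ p (n / 2)
  refine ⟨z, ?_⟩
  rintro _ ⟨_, ⟨m, -, rfl⟩, rfl⟩
  obtain ⟨a, b, h1, h2, h3, h4, h5⟩ := hz m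
  obtain ⟨k, rfl⟩ := heven
  -- At k = n/2 the width bound is max(1, -1) = 1, so the only sector of the tile is m.
  have ha : a = m := by omega
  have hb : b = m + 1 := by omega
  rw [ha, hb] at h5
  dsimp only
  rw [image_add_rhombus, add_zero]
  exact h5

theorem star_subset_apply (hn : 2 ≤ n) (hμ : 1 ≤ factor n u) (hσ : σ.CornerCondition) :
    star n ⊆ σ.apply (star n) := by
  intro s hs
  obtain ⟨m, hm, rfl⟩ := id hs
  obtain ⟨A, B, h1, h2, h3, h4, h5⟩ :=
    exists_narrower_apply σ hn hμ hσ hs (by omega) le_rfl (lt_add_one _)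
  have hA : A = m := by omega
  have hB : B = m + 1 := by omega
  rwa [hA, hB, mul_zero] at h5

end Metatiles

/-! ### The star pattern -/

theorem rhombus_mem_star {n : ℕ} (hn : 0 < n) (m : ℤ) : rhombus n 0 m (m + 1) ∈ star n := by
  have hn' : (0 : ℤ) < 2 * n := by omega
  have h0 := Int.emod_nonneg m hn'.ne'
  have h1 := Int.emod_lt_of_pos m hn'
  have h2 := Int.emod_add_mul_ediv m (2 * n)
  refine ⟨(m % (2 * n)).toNat, by omega, ?_⟩
  rw [Int.toNat_of_nonneg h0, ← rhombus_add_period hn 0 m (m + 1) (-(m / (2 * n)))]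
  congr 1 <;> linarith

theorem star_finite (n : ℕ) : (star n).Finite := by
  refine ((Set.finite_lt_nat (2 * n)).image fun m : ℕ => rhombus n 0 m (m + 1)).subset ?_
  rintro _ ⟨m, hm, rfl⟩
  exact ⟨m, hm, rfl⟩

/-- Two rhombuses of the star, at most half a turn apart, meet in an edge or in the centre. -/
theorem star_inter {n : ℕ} (hn : 2 ≤ n) {a b : ℤ} (hab : a < b) (hba : b ≤ a + n) :
    (b = a + 1 ∧ rhombus n 0 a (a + 1) ∩ rhombus n 0 b (b + 1) = segment ℝ 0 (0 + dir n b)) ∨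
      rhombus n 0 a (a + 1) ∩ rhombus n 0 b (b + 1) = {0} := by
  have hn0 : 0 < n := by omega
  have h1 : 0 < (dir n 1).im := dir_im_pos one_pos (by omega)
  have key : ∀ z ∈ rhombus n 0 a (a + 1) ∩ rhombus n 0 b (b + 1), ∃ t s' t' : ℝ,
      0 ≤ t ∧ t ≤ 1 ∧ 0 ≤ s' ∧ 0 ≤ t' ∧ z = t * dir n (a + 1) ∧
      z = s' * dir n b + t' * dir n (b + 1) ∧
      s' * (dir n (b - a - 1)).im = 0 ∧ t' * (dir n (b - a)).im = 0 := by
    rintro z ⟨⟨s, hs, t, ht, rfl⟩, s', hs', t', ht', e⟩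
    have e' : (s : ℂ) * dir n a + (t : ℂ) * dir n (a + 1) =
        (s' : ℂ) * dir n b + (t' : ℂ) * dir n (b + 1) := by linear_combination e
    have ei := congrArg (fun w => (dir n (-(a + 1)) * w).im) e'
    -- Measured from v_{a+1}, the first rhombus lies on the side im ≤ 0 and the second on im ≥ 0, so
    -- each term vanishes.
    simp only [rotate_im] at ei
    rw [show a - (a + 1) = -1 by ring, dir_neg_im, sub_self, dir_zero, Complex.one_im,
      show b - (a + 1) = b - a - 1 by ring, show b + 1 - (a + 1) = b - a by ring] at ei
    have k1 : 0 ≤ (dir n (b - a - 1)).im := dir_im_nonneg hn0 (by omega) (by omega)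
    have k2 : 0 ≤ (dir n (b - a)).im := dir_im_nonneg hn0 (by omega) (by omega)
    have k3 := mul_nonneg hs'.1 k1
    have k4 := mul_nonneg ht'.1 k2
    have k5 := mul_nonneg hs.1 h1.le
    have k6 : s * (dir n 1).im = 0 := by linarith
    have hs0 : s = 0 := (mul_eq_zero.1 k6).resolve_right h1.ne'
    exact ⟨t, s', t', ht.1, ht.2, hs'.1, ht'.1, by simp [hs0], by linear_combination e,
      by linarith, by linarith⟩
  have seg : ∀ (t : ℝ) (d : ℂ), 0 ≤ t → t ≤ 1 → (t : ℂ) * d ∈ segment ℝ 0 (0 + d) :=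
    fun t d h0 h1 => ⟨1 - t, t, by linarith, h0, by ring, by simp⟩
  have zero : (0 : ℂ) ∈ rhombus n 0 a (a + 1) ∩ rhombus n 0 b (b + 1) :=
    ⟨apex_mem_rhombus .., apex_mem_rhombus ..⟩
  by_cases hb : b = a + 1
  · left
    refine ⟨hb, Set.Subset.antisymm ?_ ?_⟩
    · intro z hz
      obtain ⟨t, s', t', ht0, ht1, -, -, rfl, -⟩ := key z hz
      rw [hb]
      exact seg t _ ht0 ht1
    · rintro _ ⟨α, β, hα, hβ, hαβ, rfl⟩
      rw [← hb]
      exact ⟨⟨0, by simp, β, ⟨hβ, by linarith⟩, by simp⟩,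
        ⟨β, ⟨hβ, by linarith⟩, 0, by simp, by simp⟩⟩
  · right
    refine Set.Subset.antisymm ?_ (by simpa using zero)
    intro z hz
    obtain ⟨t, s', t', ht0, ht1, hs', ht', e1, e2, e3, e4⟩ := key z hz
    have k1 : 0 < (dir n (b - a - 1)).im := dir_im_pos (by omega) (by omega)
    have hs0 : s' = 0 := (mul_eq_zero.1 e3).resolve_right k1.ne'
    -- For b = a + n the sine multiplying `t'` is zero and gives nothing; there the common point
    -- lies on two opposite rays instead.
    rcases hba.lt_or_eq with hlt | rfl
    · have k2 : 0 < (dir n (b - a)).im := dir_im_pos (by omega) (by omega)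
      have ht0 : t' = 0 := (mul_eq_zero.1 e4).resolve_right k2.ne'
      simp [e2, hs0, ht0]
    · rw [show a + (n : ℤ) + 1 = a + 1 + n by ring, dir_add_n hn0 (a + 1), hs0,
        Complex.ofReal_zero, zero_mul, zero_add] at e2
      have e5 : ((t + t' : ℝ) : ℂ) * dir n (a + 1) = 0 := by
        push_cast
        linear_combination e2 - e1
      have e6 : t + t' = 0 := by
        exact_mod_cast (mul_eq_zero.1 e5).resolve_right (dir_ne_zero n _)
      have e7 : t = 0 := by linarith
      simp [e1, e7]

theorem star_edgeToEdge {n : ℕ} (hn : 2 ≤ n) : EdgeToEdge n (star n) := by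
  have hn0 : 0 < n := by omega
  have half : ∀ a b : ℤ, a < b → b ≤ a + n →
      (∃ z, IsVertex n (rhombus n 0 a (a + 1)) z ∧ IsVertex n (rhombus n 0 b (b + 1)) z ∧
        rhombus n 0 a (a + 1) ∩ rhombus n 0 b (b + 1) = {z}) ∨
      (∃ e, IsEdge n (rhombus n 0 a (a + 1)) e ∧ IsEdge n (rhombus n 0 b (b + 1)) e ∧
        rhombus n 0 a (a + 1) ∩ rhombus n 0 b (b + 1) = e) := by
    intro a b hab hba
    rcases star_inter hn hab hba with ⟨rfl, h⟩ | h
    · exact Or.inr ⟨_, (isEdge_rhombus 0 (by omega) (by omega)).2,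
        (isEdge_rhombus 0 (by omega) (by omega)).1, h⟩
    · exact Or.inl ⟨0, (isTile_rhombus 0 (by omega) (by omega)).2,
        (isTile_rhombus 0 (by omega) (by omega)).2, h⟩
  have ordered : ∀ a b : ℤ, a < b → b < a + 2 * n →
      (∃ z, IsVertex n (rhombus n 0 a (a + 1)) z ∧ IsVertex n (rhombus n 0 b (b + 1)) z ∧
        rhombus n 0 a (a + 1) ∩ rhombus n 0 b (b + 1) = {z}) ∨
      (∃ e, IsEdge n (rhombus n 0 a (a + 1)) e ∧ IsEdge n (rhombus n 0 b (b + 1)) e ∧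
        rhombus n 0 a (a + 1) ∩ rhombus n 0 b (b + 1) = e) := by
    intro a b hab hba
    by_cases h : b ≤ a + n
    · exact half a b hab h
    -- More than half a turn apart one way is less than half a turn apart the other way.
    · have := half b (a + 2 * n * 1) (by omega) (by omega)
      rw [show a + 2 * n * 1 + 1 = a + 1 + 2 * n * 1 by ring, rhombus_add_period hn0,
        Set.inter_comm] at this
      rcases this with ⟨z, h1, h2, h3⟩ | ⟨e, h1, h2, h3⟩
      · exact Or.inl ⟨z, h2, h1, h3⟩
      · exact Or.inr ⟨e, h2, h1, h3⟩
  refine ⟨?_, ?_⟩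
  · rintro _ ⟨m, -, rfl⟩
    exact (isTile_rhombus 0 (by omega) (by omega)).1
  · rintro _ ⟨a, ha, rfl⟩ _ ⟨b, hb, rfl⟩ hne
    right
    rcases lt_trichotomy a b with h | rfl | h
    · exact ordered a b (by omega) (by omega)
    · exact absurd rfl hne
    · rw [Set.inter_comm]
      rcases ordered b a (by omega) (by omega) with ⟨z, h1, h2, h3⟩ | ⟨e, h1, h2, h3⟩
      · exact Or.inl ⟨z, h2, h1, h3⟩
      · exact Or.inr ⟨e, h2, h1, h3⟩

theorem star_isPatch {n : ℕ} (hn : 2 ≤ n) : IsPatch n (star n) := by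
  refine ⟨star_finite n, star_edgeToEdge hn, ?_⟩
  -- Simple connectedness comes from contractibility of a star-shaped set.
  have hc : StarConvex ℝ (0 : ℂ) (⋃₀ star n) := by
    apply starConvex_sUnion
    rintro _ ⟨m, -, rfl⟩
    rintro _ ⟨s, hs, t, ht, rfl⟩ α β hα hβ hαβ
    refine ⟨β * s, ⟨mul_nonneg hβ hs.1, ?_⟩, β * t, ⟨mul_nonneg hβ ht.1, ?_⟩, ?_⟩
    · nlinarith [hs.1, hs.2]
    · nlinarith [ht.1, ht.2]
    · simp only [Complex.real_smul]
      push_cast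
      ring
  have hne : (⋃₀ star n).Nonempty :=
    ⟨0, _, rhombus_mem_star (by omega) 0, apex_mem_rhombus ..⟩
  have := hc.contractibleSpace hne
  infer_instance

/-! ### Discs around and inside the star. -/

/-- Since cos(π/n) ≥ 0, the norm on each rhombus is largest at the vertex opposite 0. The antipodal
pair ±(1 + v_1) shows that no smaller disc works. -/
theorem star_isCircumscribed {n : ℕ} (hn : 2 ≤ n) :
    IsCircumscribed (⋃₀ star n) 0 ‖dir n 0 + dir n 1‖ := by
  have hn0 : 0 < n := by omega
  have hcos : 0 ≤ Real.cos (Real.pi / n) := by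
    have hn' : (2 : ℝ) ≤ n := by exact_mod_cast hn
    have hπ := Real.pi_pos
    apply Real.cos_nonneg_of_neg_pi_div_two_le_of_le
    · have : 0 ≤ Real.pi / n := by positivity
      linarith
    · exact div_le_div_of_nonneg_left hπ.le two_pos hn'
  have hre : (dir n 1).re = Real.cos (Real.pi / n) := by
    rw [dir_re]
    simp
  have hnorm : ∀ s t : ℝ, ‖(s : ℂ) * dir n 0 + t * dir n 1‖ ^ 2 =
      s ^ 2 + t ^ 2 + 2 * s * t * Real.cos (Real.pi / n) := by
    intro s t
    have h1 := Complex.sq_norm (dir n 1)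
    rw [norm_dir, Complex.normSq_apply] at h1
    rw [Complex.sq_norm, Complex.normSq_apply, dir_zero, ← hre]
    simp only [Complex.add_re, Complex.add_im, Complex.mul_re, Complex.mul_im, Complex.ofReal_re,
      Complex.ofReal_im, Complex.one_re, Complex.one_im]
    linear_combination (-t ^ 2) * h1
  constructor
  · rintro _ ⟨_, ⟨m, -, rfl⟩, s, hs, t, ht, rfl⟩
    rw [mem_closedBall_zero_iff]
    have e : (0 : ℂ) + s * dir n m + t * dir n (m + 1) =
        dir n m * (s * dir n 0 + t * dir n 1) := by
      rw [dir_add, dir_zero]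
      ring
    rw [e, norm_mul, norm_dir, one_mul]
    have h1 := hnorm s t
    have h2 := hnorm 1 1
    simp only [Complex.ofReal_one, one_mul] at h2
    apply le_of_sq_le_sq _ (norm_nonneg _)
    rw [h1, h2]
    have hst : s * t ≤ 1 := by nlinarith [hs.1, hs.2, ht.1, ht.2]
    nlinarith [hs.1, hs.2, ht.1, ht.2, mul_le_mul_of_nonneg_right hst hcos]
  · intro c R hR
    have h1 : dir n 0 + dir n 1 ∈ Metric.closedBall c R := by
      refine hR ⟨_, rhombus_mem_star hn0 0, 1, by simp, 1, by simp, by simp⟩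
    have h2 : -(dir n 0 + dir n 1) ∈ Metric.closedBall c R := by
      refine hR ⟨_, rhombus_mem_star hn0 (0 + n), 1, by simp, 1, by simp, ?_⟩
      rw [show (0 : ℤ) + n + 1 = 1 + n by ring, dir_add_n hn0, dir_add_n hn0]
      push_cast
      ring
    rw [mem_closedBall_iff_norm] at h1 h2
    have h3 := norm_sub_le (dir n 0 + dir n 1 - c) (-(dir n 0 + dir n 1) - c)
    have e : dir n 0 + dir n 1 - c - (-(dir n 0 + dir n 1) - c) = 2 * (dir n 0 + dir n 1) := by
      ring
    rw [e, norm_mul, Complex.norm_ofNat] at h3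
    linarith

theorem norm_dir_add_dir_lt {n : ℕ} (hn : 2 ≤ n) : ‖dir n 0 + dir n 1‖ < 2 := by
  have h4 : 0 < (dir n 1).im := dir_im_pos one_pos (by omega)
  have h1 := Complex.sq_norm (dir n 1)
  have h2 := Complex.sq_norm (dir n 0 + dir n 1)
  rw [norm_dir, Complex.normSq_apply] at h1
  rw [Complex.normSq_apply, dir_zero] at h2
  simp only [Complex.add_re, Complex.add_im, Complex.one_re, Complex.one_im] at h2
  have hc : (dir n 1).re < 1 := by nlinarith
  rw [dir_zero]
  apply lt_of_pow_lt_pow_left₀ 2 two_pos.le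
  nlinarith

theorem closedBall_subset_star {n : ℕ} (hn : 2 ≤ n) :
    Metric.closedBall (0 : ℂ) 1 ⊆ ⋃₀ star n := by
  intro w hw
  rw [mem_closedBall_zero_iff] at hw
  have hn' : (2 : ℝ) ≤ n := by exact_mod_cast hn
  have hπ := Real.pi_pos
  have hθ : 0 < Real.pi / n := by positivity
  have hθ2 : Real.pi / n ≤ Real.pi / 2 := div_le_div_of_nonneg_left hπ.le two_pos hn'
  -- This is the sector containing `w`. Its two coordinates there are |w| sin x / sin(π/n) with 0 ≤
  -- x ≤ π/n ≤ π/2, hence at most 1 when |w| ≤ 1.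
  set m : ℤ := ⌊w.arg / (Real.pi / n)⌋ with hm
  have hm1 : (m : ℝ) * (Real.pi / n) ≤ w.arg := by
    rw [← le_div_iff₀ hθ]
    exact Int.floor_le _
  have hm2 : w.arg < ((m : ℝ) + 1) * (Real.pi / n) := by
    rw [← div_lt_iff₀ hθ]
    exact Int.lt_floor_add_one _
  clear_value m
  have him : ∀ a : ℤ, (dir n (-a) * w).im = ‖w‖ * Real.sin (w.arg - a * (Real.pi / n)) := by
    intro a
    have hna : (((-a : ℤ) : ℝ)) * Real.pi / n = -(a * (Real.pi / n)) := by push_cast; ring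
    rw [Complex.mul_im, dir_re, dir_im, hna, Real.sin_neg, Real.cos_neg, Real.sin_sub]
    linear_combination (-Real.cos (a * (Real.pi / n))) * Complex.norm_mul_sin_arg w +
      Real.sin (a * (Real.pi / n)) * Complex.norm_mul_cos_arg w
  have hsin : 0 < Real.sin (Real.pi / n) := Real.sin_pos_of_pos_of_lt_pi hθ (by linarith)
  have bound : ∀ x : ℝ, 0 ≤ x → x ≤ Real.pi / n →
      0 ≤ ‖w‖ * Real.sin x / Real.sin (Real.pi / n) ∧
      ‖w‖ * Real.sin x / Real.sin (Real.pi / n) ≤ 1 := by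
    intro x h0 h1
    have k0 : 0 ≤ Real.sin x := Real.sin_nonneg_of_nonneg_of_le_pi h0 (by linarith)
    have k1 : Real.sin x ≤ Real.sin (Real.pi / n) :=
      Real.sin_le_sin_of_le_of_le_pi_div_two (by linarith) hθ2 h1
    refine ⟨by positivity, ?_⟩
    rw [div_le_one hsin]
    calc ‖w‖ * Real.sin x ≤ 1 * Real.sin x := mul_le_mul_of_nonneg_right hw k0
      _ ≤ Real.sin (Real.pi / n) := by rwa [one_mul]
  obtain ⟨s, t, h, hs, ht⟩ := exists_coeff (n := n) (a := m) (b := m + 1) (by omega) (by omega) w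
  have e1 : (dir n (m + 1 - m)).im = Real.sin (Real.pi / n) := by
    rw [add_sub_cancel_left, dir_im]
    simp
  rw [e1, him] at hs ht
  refine ⟨_, rhombus_mem_star (by omega) m, s, ?_, t, ?_, by rw [h]; ring⟩
  · rw [hs, ← mul_neg, ← Real.sin_neg]
    push_cast
    exact bound _ (by linarith) (by linarith)
  · rw [ht]
    exact bound _ (by linarith) (by linarith)

theorem smul_sUnion_subset_sUnion_apply {n : ℕ} {u : List ℕ} (σ : Substitution n u)
    {P : Set (Set ℂ)} (hP : ∀ s ∈ P, IsTile n s) {w : ℂ} (hw : w ∈ ⋃₀ P) :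
    (factor n u : ℂ) * w ∈ ⋃₀ σ.apply P := by
  obtain ⟨s, hs, hws⟩ := hw
  obtain ⟨x, p, rfl⟩ := hP s hs
  have h : (factor n u : ℂ) * (w - x) ∈ ⋃₀ σ.metatile p := by
    rw [σ.covers p]
    left
    obtain ⟨α, hα, β, hβ, rfl⟩ := hws
    exact ⟨_, ⟨α, hα, β, hβ, rfl⟩, by ring⟩
  obtain ⟨t, ht, hwt⟩ := h
  exact ⟨_, ⟨x, p, hs, t, ht, rfl⟩, _, hwt, by ring⟩

theorem star_isSeed {n : ℕ} {u : List ℕ} (σ : Substitution n u) (hn : 2 ≤ n)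
    (hμ : 2 ≤ factor n u) (hσ : σ.CornerCondition) : σ.IsSeed (star n) := by
  refine ⟨star_isPatch hn, 0, ‖dir n 0 + dir n 1‖, 2, star_isCircumscribed hn, ?_,
    norm_dir_add_dir_lt hn, ?_⟩
  · rintro _ ⟨s, hs, rfl⟩
    simpa using star_subset_apply σ hn (by linarith) hσ hs
  · intro w hw
    rw [mul_zero, mem_closedBall_zero_iff] at hw
    have hμ0 : 0 < factor n u := by linarith
    have hμ' : (factor n u : ℂ) ≠ 0 := by exact_mod_cast hμ0.ne'
    -- As |w| ≤ 2 ≤ μ, the point w/μ is in the unit disc, which the star contains.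
    have h : w / factor n u ∈ ⋃₀ star n := by
      apply closedBall_subset_star hn
      rw [mem_closedBall_zero_iff, norm_div, Complex.norm_real, Real.norm_of_nonneg hμ0.le,
        div_le_one hμ0]
      linarith
    have := smul_sUnion_subset_sUnion_apply σ (star_edgeToEdge hn).1 h
    rwa [mul_div_cancel₀ _ hμ'] at this

end PlanarRosa

theorem mainTheorem7 (n : ℕ) (hn : 4 ≤ n) (hn_even : Even n) (i : ℕ)
    (σ : PlanarRosa.Substitution n (PlanarRosa.candidateWord n i))
    (hwd : σ.WellDefined) (hcorner : σ.CornerCondition) :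
    σ.IsSeed (PlanarRosa.star n) ∧
    σ.IsLegal (PlanarRosa.star n) ∧
    PlanarRosa.star n ⊆ σ.apply (PlanarRosa.star n) ∧
    ∀ p : PlanarRosa.Prototile n,
      PlanarRosa.Appears (PlanarRosa.star n) (σ.iterate (n / 2 + 1) p) := by
  have hn2 : 2 ≤ n := by omega
  have hμ := PlanarRosa.two_le_factor hn2 (hcorner.ne_zero hn2)
  have hlegal := PlanarRosa.star_appears σ hn2 hn_even hμ hcorner
  exact ⟨PlanarRosa.star_isSeed σ hn2 hμ hcorner,
    ⟨⟨0, 1, one_pos, by omega⟩, n / 2 + 1, hlegal _⟩,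
    PlanarRosa.star_subset_apply σ hn2 (by linarith) hcorner, hlegal⟩
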